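/- Let $d\ge 1$ and $h\le 2d-2$ be integers. The sandpile model on $\mathbb{Z}^d$ with background height $h$ and $n\ge 0$ particles starts from the configuration with height $H(\mathbf 0)=n$, height $H(\mathbf x)=h$ at every $\mathbf x\ne\mathbf 0$, and toppling numbers $T\equiv 0$. A toppling of a site $\mathbf x$ increases $T(\mathbf x)$ by $1$, decreases $H(\mathbf x)$ by $2d$, and increases $H(\mathbf y)$ by $1$ for each of the $2d$ nearest neighbours $\mathbf y$ of $\mathbf x$; it is legal if $H(\mathbf x)\ge 0$ after the toppling. A final configuration $(H_n,T_n)$ is one that is reached from the initial configuration by finitely many legal topplings and satisfies $H_n(\mathbf x)\le 2d-1$ for all $\mathbf x$. For $\mathbf x\in\mathbb{Z}^d$ let $\mathbf x^\square=\mathbf x+[-\tfrac12,\tfrac12]^d\subset\mathbb{R}^d$, and define the particle cluster $$\mathcal V_n=\bigcup_{\mathbf x:\,T_n(\mathbf x)>0}\mathbf x^\square\ \cup\bigcup_{\mathbf x:\,H_n(\mathbf x)>h}\mathbf x^\square .$$ Proposition. For every $n>h$, a final configuration exists, and for every final configuration the particle cluster $\mathcal V_n$, with the topology induced from $\mathbb{R}^d$,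 is simply connected (path connected with trivial fundamental group). (For $n\le h$ no site topples and $\mathcal V_n$ is empty.) -/

import Mathlib

namespace Sandpile

/-- A configuration on `ℤ^d`: the particle function `H` and the toppling function `T`.
(For the sandpile model every toppling sends one particle in each of the `2d` directions, so
no direction function is needed.) -/
structure Config (d : ℕ) where
  /-- the (possibly negative) number of particles at each site -/
  H : (Fin d → ℤ) → ℤ
  /-- the number of topplings performed so far at each site -/
  T : (Fin d → ℤ) → ℤ

/-- The initial configuration: `n` particles at the origin, background height `h` at every other
site, and no topplings yet. -/
def initial (d n : ℕ) (h : ℤ) : Config d where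
  H := fun x => if x = 0 then (n : ℤ) else h
  T := fun _ => 0

/-- Two sites of `ℤ^d` are neighbours if they differ by a (positive or negative) unit vector. -/
abbrev Neighbor {d : ℕ} (x y : Fin d → ℤ) : Prop := ∑ i, |y i - x i| = 1

/-- Toppling the site `x`: its toppling number goes up by one, it loses `2d` particles, and each
of its `2d` neighbours receives one of them. -/
def topple {d : ℕ} (η : Config d) (x : Fin d → ℤ) : Config d where
  H := fun y => η.H y - (if y = x then 2 * (d : ℤ) else 0) + (if Neighbor x y then 1 else 0)
  T := fun y => η.T y + (if y = x then 1 else 0)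

/-- `η'` arises from `η` by one legal toppling: after toppling, the height of the toppled site is
nonnegative. -/
def LegalStep {d : ℕ} (η η' : Config d) : Prop :=
  ∃ x : Fin d → ℤ, η' = topple η x ∧ 0 ≤ η'.H x

/-- All sites are stable: the height is at most `h_max = 2d - 1` everywhere. -/
def IsStable {d : ℕ} (η : Config d) : Prop :=
  ∀ x, η.H x ≤ 2 * (d : ℤ) - 1

/-- `η` is a final configuration of the model with `n` particles and background height `h`: it is
stable and is reached from the initial configuration by finitely many legal topplings. -/
def IsFinal (d n : ℕ) (h : ℤ) (η : Config d) : Prop :=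
  Relation.ReflTransGen LegalStep (initial d n h) η ∧ IsStable η

/-- The closed unit cube in `ℝ^d` centred at the lattice site `x`. -/
def unitCube {d : ℕ} (x : Fin d → ℤ) : Set (EuclideanSpace ℝ (Fin d)) :=
  {y | ∀ i, y i - (x i : ℝ) ∈ Set.Icc (-(1 / 2) : ℝ) (1 / 2)}

/-- The toppling cluster: the union of the unit cubes around the sites that have toppled. -/
def topplingCluster {d : ℕ} (η : Config d) : Set (EuclideanSpace ℝ (Fin d)) :=
  ⋃ x ∈ {x : Fin d → ℤ | 0 < η.T x}, unitCube x

/-- The particle cluster: the toppling cluster together with the unit cubes around the sites whose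
height exceeds the background height `h`. -/
def particleCluster {d : ℕ} (h : ℤ) (η : Config d) : Set (EuclideanSpace ℝ (Fin d)) :=
  topplingCluster η ∪ ⋃ x ∈ {x : Fin d → ℤ | h < η.H x}, unitCube x

end Sandpile

/-!
Along any toppling sequence `H = H₀ + Δ T`, where `Δ` is the lattice Laplacian
(`Reachable.height_eq`). Call `u ≥ 0` *stabilizing* if `H₀ + Δ u ≤ 2d - 1`. By the least action
principle (`Reachable.le_of_isStabilizing`), the toppling function of any legally reached
configuration lies below every stabilizing function; the toppling function `T` of a final
configuration is stabilizing itself, hence it is the least stabilizing function.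

*Existence.* With `g k = k (k + 1) / 2` and the truncated difference, `u x = g (n - ‖x‖_∞)` has
finite support, satisfies `Δ u ≤ 1` off the origin, and `Δ u 0 = -2 d n`. Since `h + 1 ≤ 2d - 1`,
it is stabilizing (`isStabilizing_pyramid`), so every legal sequence stops.

*Shape.* `T` is invariant under `x_j ↦ -x_j`, by minimality. For the reflection `R : x_j ↦ 1 - x_j`,
replacing `T` by `min T (T ∘ R)` on the half space `x_j ≥ 1`, which does not contain the origin,
yields a stabilizing function again (a discrete moving plane argument), so that `T ≤ T ∘ R` there.
Together these say that `T x` is nonincreasing in every `|x_j|`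
(`IsLeastStabilizing.le_of_abs_le`). The sites of the particle cluster are the origin, the toppled
sites and their neighbours, so they too form a set that is closed under decreasing the `|x_j|`
(`IsFinal.mem_of_abs_le`). A union of unit cubes over such a set is star convex about the origin,
hence contractible.
-/

namespace Sandpile

variable {d : ℕ}

/-! ### The lattice Laplacian -/

/-- The discrete Laplacian on `ℤ^d`: the sum over the `2d` neighbours of the differences. -/
def lap (f : (Fin d → ℤ) → ℤ) (x : Fin d → ℤ) : ℤ :=
  ∑ i, (f (x + Pi.single i 1) + f (x - Pi.single i 1) - 2 * f x)

lemma lap_add (f g : (Fin d → ℤ) → ℤ) (x : Fin d → ℤ) :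
    lap (fun y => f y + g y) x = lap f x + lap g x := by
  simp only [lap, ← Finset.sum_add_distrib]
  exact Finset.sum_congr rfl fun i _ => by ring

lemma lap_le_lap {f g : (Fin d → ℤ) → ℤ} {x : Fin d → ℤ} (hx : f x = g x)
    (hp : ∀ i, f (x + Pi.single i 1) ≤ g (x + Pi.single i 1))
    (hm : ∀ i, f (x - Pi.single i 1) ≤ g (x - Pi.single i 1)) : lap f x ≤ lap g x :=
  Finset.sum_le_sum fun i _ => by linarith [hp i, hm i]

/-- At a zero of a nonnegative function, the Laplacian is positive exactly if the function is
positive at some neighbour. -/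
lemma lap_pos_iff {f : (Fin d → ℤ) → ℤ} (hf : ∀ y, 0 ≤ f y) {x : Fin d → ℤ} (hx : f x = 0) :
    0 < lap f x ↔ ∃ i, 0 < f (x + Pi.single i 1) ∨ 0 < f (x - Pi.single i 1) := by
  have h0 : ∀ i ∈ Finset.univ,
      0 ≤ f (x + Pi.single i 1) + f (x - Pi.single i 1) - 2 * f x := fun i _ => by
    linarith [hf (x + Pi.single i 1), hf (x - Pi.single i 1)]
  rw [lap, Finset.sum_pos_iff_of_nonneg h0]
  simp only [Finset.mem_univ, true_and, hx]
  refine exists_congr fun i => ?_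
  have h1 := hf (x + Pi.single i 1)
  have h2 := hf (x - Pi.single i 1)
  omega

lemma neighbor_iff {x y : Fin d → ℤ} :
    Neighbor x y ↔ ∃ i, y + Pi.single i 1 = x ∨ y - Pi.single i 1 = x := by
  constructor
  · intro hxy
    have hxy' : ∑ i, |y i - x i| = 1 := hxy
    obtain ⟨i, hi⟩ : ∃ i, y i - x i ≠ 0 := by
      by_contra! h0
      simp [h0] at hxy'
    have hsum := Finset.add_sum_erase Finset.univ (fun i => |y i - x i|) (Finset.mem_univ i)
    have hnn : ∀ k ∈ Finset.univ.erase i, 0 ≤ |y k - x k| := fun k _ => abs_nonneg _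
    have h1 : 1 ≤ |y i - x i| := Int.one_le_abs hi
    have hrest : ∑ k ∈ Finset.univ.erase i, |y k - x k| = 0 := by
      have := Finset.sum_nonneg hnn
      linarith
    have hother : ∀ k, k ≠ i → y k = x k := fun k hk => by
      have := (Finset.sum_eq_zero_iff_of_nonneg hnn).1 hrest k (by simp [hk])
      rw [abs_eq_zero] at this
      omega
    have hone : |y i - x i| = 1 := by linarith
    refine ⟨i, ?_⟩
    rcases (abs_eq (by norm_num)).1 hone with h2 | h2
    · right
      ext k
      by_cases hk : k = i
      · subst hk; simp; omega
      · simp [hk, hother k hk]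
    · left
      ext k
      by_cases hk : k = i
      · subst hk; simp; omega
      · simp [hk, hother k hk]
  · rintro ⟨i, rfl | rfl⟩ <;> simp [Neighbor, Pi.single_apply, apply_ite abs]

/-- Toppling `x` changes the heights by the Laplacian of the indicator function of `x`. -/
lemma lap_indicator (x y : Fin d → ℤ) :
    lap (fun z => if z = x then 1 else 0) y =
      -(if y = x then 2 * (d : ℤ) else 0) + (if Neighbor x y then 1 else 0) := by
  have hnb : ∑ i, ((if y + Pi.single i 1 = x then (1 : ℤ) else 0) +
      (if y - Pi.single i 1 = x then 1 else 0)) = if Neighbor x y then 1 else 0 := by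
    split_ifs with hxy
    · obtain ⟨i, hi⟩ := neighbor_iff.1 hxy
      rw [Finset.sum_eq_single i]
      · have hne : ¬(y + Pi.single i 1 = x ∧ y - Pi.single i 1 = x) := by
          rintro ⟨h1, h2⟩
          have h1 := congrFun h1 i
          have h2 := congrFun h2 i
          simp at h1 h2
          omega
        rcases hi with hi | hi
        · rw [if_pos hi, if_neg fun h2 => hne ⟨hi, h2⟩]; rfl
        · rw [if_pos hi, if_neg fun h1 => hne ⟨h1, hi⟩]; rfl
      · intro k _ hk
        have hxi : y i ≠ x i := by
          rcases hi with rfl | rfl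
          · simp
          · simp only [Pi.sub_apply, Pi.single_eq_same]
            omega
        have h1 : y + Pi.single k 1 ≠ x := fun h1 => hxi <| by
          simpa [Ne.symm hk] using congrFun h1 i
        have h2 : y - Pi.single k 1 ≠ x := fun h1 => hxi <| by
          simpa [Ne.symm hk] using congrFun h1 i
        simp [h1, h2]
      · simp
    · have := fun i => mt (fun h => neighbor_iff.2 ⟨i, h⟩) hxy
      simp only [not_or] at this
      simp [this]
  rw [lap, Finset.sum_sub_distrib, hnb]
  split_ifs <;> simp <;> ring

/-- The reflection of `ℤ^d` that sends `x_j` to `c - x_j`. -/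
def reflect (j : Fin d) (c : ℤ) (x : Fin d → ℤ) : Fin d → ℤ :=
  Function.update x j (c - x j)

@[simp] lemma reflect_reflect (j : Fin d) (c : ℤ) (x : Fin d → ℤ) :
    reflect j c (reflect j c x) = x := by
  simp [reflect]

lemma reflect_zero_eq_zero_iff {j : Fin d} {x : Fin d → ℤ} : reflect j 0 x = 0 ↔ x = 0 := by
  have h0 : reflect j 0 (0 : Fin d → ℤ) = 0 := by simp [reflect]
  constructor
  · intro hx
    rw [← reflect_reflect j 0 x, hx, h0]
  · rintro rfl
    exact h0

lemma lap_comp_reflect (f : (Fin d → ℤ) → ℤ) (j : Fin d) (c : ℤ) (x : Fin d → ℤ) :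
    lap (fun y => f (reflect j c y)) x = lap f (reflect j c x) := by
  refine Finset.sum_congr rfl fun i _ => ?_
  by_cases hij : i = j
  · subst hij
    have h1 : reflect i c (x + Pi.single i 1) = reflect i c x - Pi.single i 1 := by
      ext k
      by_cases hk : k = i
      · subst hk; simp [reflect]; ring
      · simp [reflect, hk]
    have h2 : reflect i c (x - Pi.single i 1) = reflect i c x + Pi.single i 1 := by
      ext k
      by_cases hk : k = i
      · subst hk; simp [reflect]; ring
      · simp [reflect, hk]
    simp only [h1, h2]; ring
  · have h1 : reflect j c (x + Pi.single i 1) = reflect j c x + Pi.single i 1 := by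
      ext k
      by_cases hk : k = j
      · subst hk; simp [reflect, Ne.symm hij]
      · simp [reflect, hk]
    have h2 : reflect j c (x - Pi.single i 1) = reflect j c x - Pi.single i 1 := by
      ext k
      by_cases hk : k = j
      · subst hk; simp [reflect, Ne.symm hij]
      · simp [reflect, hk]
    simp only [h1, h2]

/-! ### The least action principle -/

/-- The configuration `η` is reached from the initial one by finitely many legal topplings. -/
def Reachable (d n : ℕ) (h : ℤ) (η : Config d) : Prop :=
  Relation.ReflTransGen LegalStep (initial d n h) η

/-- A nonnegative function `u` such that toppling every site `x` exactly `u x` times, legally or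
not, makes the initial configuration stable. -/
structure IsStabilizing (d n : ℕ) (h : ℤ) (u : (Fin d → ℤ) → ℤ) : Prop where
  nonneg : ∀ x, 0 ≤ u x
  height_le : ∀ x, (initial d n h).H x + lap u x ≤ 2 * (d : ℤ) - 1

variable {n : ℕ} {h : ℤ} {η : Config d} {u : (Fin d → ℤ) → ℤ}

lemma topple_H (η : Config d) (x y : Fin d → ℤ) :
    (topple η x).H y = η.H y + lap (fun z => if z = x then 1 else 0) y := by
  rw [lap_indicator]
  simp only [topple]
  ring

lemma Reachable.height_eq (hη : Reachable d n h η) (x : Fin d → ℤ) :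
    η.H x = (initial d n h).H x + lap η.T x := by
  induction hη with
  | refl => simp [initial, lap]
  | tail _ hstep ih =>
    obtain ⟨z, rfl, _⟩ := hstep
    rw [topple_H, ih, add_assoc, ← lap_add]
    rfl

lemma Reachable.nonneg (hη : Reachable d n h η) (x : Fin d → ℤ) : 0 ≤ η.T x := by
  induction hη with
  | refl => simp [initial]
  | tail _ hstep ih =>
    obtain ⟨z, rfl, _⟩ := hstep
    simp only [topple]
    split_ifs <;> omega

lemma topple_H_self (η : Config d) (x : Fin d → ℤ) :
    (topple η x).H x = η.H x - 2 * (d : ℤ) := by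
  simp [topple, Neighbor]

/-- The least action principle. A site `x` with `T x = u x` while `T ≤ u` elsewhere has height at
most `2d - 1`, so it cannot topple legally. -/
lemma Reachable.le_of_isStabilizing (hη : Reachable d n h η) (hu : IsStabilizing d n h u)
    (x : Fin d → ℤ) : η.T x ≤ u x := by
  induction hη generalizing x with
  | refl => exact hu.nonneg x
  | @tail ξ _ hξ hstep ih =>
    obtain ⟨z, rfl, hz⟩ := hstep
    simp only [topple]
    split_ifs with hxz
    · subst hxz
      refine (ih x).lt_of_ne fun heq => ?_
      have h1 := hu.height_le x
      have h2 := lap_le_lap heq (fun i => ih _) fun i => ih _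
      have h3 := Reachable.height_eq hξ x
      rw [topple_H_self] at hz
      linarith
    · simpa using ih x

/-- `u` is the (pointwise) least stabilizing function. -/
structure IsLeastStabilizing (d n : ℕ) (h : ℤ) (u : (Fin d → ℤ) → ℤ) : Prop
    extends IsStabilizing d n h u where
  le : ∀ v, IsStabilizing d n h v → ∀ x, u x ≤ v x

lemma IsFinal.isLeastStabilizing (hη : IsFinal d n h η) : IsLeastStabilizing d n h η.T where
  nonneg := Reachable.nonneg hη.1
  height_le x := by
    rw [← Reachable.height_eq hη.1]
    exact hη.2 x
  le _ hv := Reachable.le_of_isStabilizing hη.1 hv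

/-! ### Existence of a final configuration -/

/-- The triangular number `0 + 1 + ⋯ + k`. -/
def triangular (k : ℕ) : ℤ := ∑ i ∈ Finset.range (k + 1), (i : ℤ)

@[simp] lemma triangular_zero : triangular 0 = 0 := by simp [triangular]

lemma triangular_succ (k : ℕ) : triangular (k + 1) = triangular k + (k + 1) := by
  rw [triangular, Finset.sum_range_succ]
  simp [triangular]

lemma triangular_mono : Monotone triangular :=
  monotone_nat_of_le_succ fun k => by rw [triangular_succ]; linarith

/-- The truncated function `k ↦ triangular (m - k)` has second difference at most `1`. -/
lemma triangular_sub_add_le (m k : ℕ) :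
    triangular (m - (k + 2)) + triangular (m - k) ≤ 2 * triangular (m - (k + 1)) + 1 := by
  obtain hm | hm := Nat.lt_or_ge m (k + 2)
  · have h1 : m - (k + 2) = 0 := by omega
    have h2 : m - (k + 1) = 0 := by omega
    have h3 : m - k ≤ 1 := by omega
    have h4 := triangular_mono h3
    have h5 : triangular 1 = 1 := by simp [triangular_succ 0]
    rw [h1, h2, triangular_zero]
    linarith
  · obtain ⟨l, rfl⟩ := Nat.exists_eq_add_of_le hm
    have h1 : k + 2 + l - (k + 2) = l := by omega
    have h2 : k + 2 + l - (k + 1) = l + 1 := by omega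
    have h3 : k + 2 + l - k = l + 1 + 1 := by omega
    rw [h1, h2, h3, triangular_succ (l + 1), triangular_succ l]
    push_cast
    linarith

/-- The sup norm on `ℤ^d`, with values in `ℕ`. -/
def supNorm (x : Fin d → ℤ) : ℕ := Finset.univ.sup fun i => (x i).natAbs

lemma natAbs_le_supNorm (x : Fin d → ℤ) (i : Fin d) : (x i).natAbs ≤ supNorm x :=
  Finset.le_sup (f := fun i => (x i).natAbs) (Finset.mem_univ i)

lemma supNorm_le_iff {x : Fin d → ℤ} {k : ℕ} : supNorm x ≤ k ↔ ∀ i, (x i).natAbs ≤ k := by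
  simp [supNorm]

lemma supNorm_le_supNorm_add_single (x : Fin d → ℤ) (i : Fin d) (s : ℤ) :
    supNorm x ≤ supNorm (x + Pi.single i s) + s.natAbs := by
  rw [supNorm_le_iff]
  intro k
  have h1 := natAbs_le_supNorm (x + Pi.single i s) k
  by_cases hk : k = i
  · subst hk
    simp only [Pi.add_apply, Pi.single_eq_same] at h1
    omega
  · simp only [Pi.add_apply, Pi.single_eq_of_ne hk, add_zero] at h1
    omega

/-- A concentric function on cubes with support `‖x‖_∞ < m`. It is the minimum over `j` of
the one-variable functions `triangular (m - |x_j|)`, each of which has Laplacian at most `1`. -/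
def pyramid (m : ℕ) (x : Fin d → ℤ) : ℤ := triangular (m - supNorm x)

lemma lap_pyramid_le_one (m : ℕ) {x : Fin d → ℤ} (hx : x ≠ 0) : lap (pyramid m) x ≤ 1 := by
  obtain ⟨i₀, hi₀⟩ := Function.ne_iff.1 hx
  -- Only a coordinate in which the sup norm is attained can contribute positively.
  obtain ⟨j, -, hj⟩ := Finset.exists_mem_eq_sup Finset.univ ⟨i₀, Finset.mem_univ i₀⟩
    fun i => (x i).natAbs
  have hj' : supNorm x = (x j).natAbs := hj
  have hpos : 0 < supNorm x := lt_of_lt_of_le (Int.natAbs_pos.2 hi₀) (natAbs_le_supNorm x i₀)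
  obtain ⟨k, hk⟩ : ∃ k, supNorm x = k + 1 := ⟨supNorm x - 1, by omega⟩
  have hle : ∀ y : Fin d → ℤ, supNorm x ≤ supNorm y → pyramid m y ≤ pyramid m x := fun y hy =>
    triangular_mono (by omega)
  have hout : ∀ y : Fin d → ℤ, k + 2 ≤ supNorm y → pyramid m y ≤ triangular (m - (k + 2)) :=
    fun y hy => triangular_mono (by omega)
  have hin : ∀ y : Fin d → ℤ, k ≤ supNorm y → pyramid m y ≤ triangular (m - k) :=
    fun y hy => triangular_mono (by omega)
  rw [lap, ← Finset.add_sum_erase Finset.univ _ (Finset.mem_univ j)]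
  have hrest : ∑ i ∈ Finset.univ.erase j, (pyramid m (x + Pi.single i 1) +
      pyramid m (x - Pi.single i 1) - 2 * pyramid m x) ≤ 0 := by
    refine Finset.sum_nonpos fun i hi => ?_
    have hij : j ≠ i := (Finset.ne_of_mem_erase hi).symm
    have h1 := hle (x + Pi.single i 1) <| by
      have := natAbs_le_supNorm (x + Pi.single i 1) j
      rwa [Pi.add_apply, Pi.single_eq_of_ne hij, add_zero, ← hj'] at this
    have h2 := hle (x - Pi.single i 1) <| by
      have := natAbs_le_supNorm (x - Pi.single i 1) j
      rwa [Pi.sub_apply, Pi.single_eq_of_ne hij, sub_zero, ← hj'] at this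
    linarith
  have hx' : pyramid m x = triangular (m - (k + 1)) := by rw [pyramid, hk]
  have hmain : pyramid m (x + Pi.single j 1) + pyramid m (x - Pi.single j 1) ≤
      triangular (m - (k + 2)) + triangular (m - k) := by
    have h1 := natAbs_le_supNorm (x + Pi.single j 1) j
    have h2 := natAbs_le_supNorm (x - Pi.single j 1) j
    have h3 := supNorm_le_supNorm_add_single x j 1
    have h4 := supNorm_le_supNorm_add_single x j (-1)
    rw [Pi.single_neg, ← sub_eq_add_neg] at h4
    simp only [Pi.add_apply, Pi.sub_apply, Pi.single_eq_same] at h1 h2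
    obtain hs | hs := le_total 0 (x j)
    · exact add_le_add (hout _ (by omega)) (hin _ (by omega))
    · rw [add_comm (triangular _)]
      exact add_le_add (hin _ (by omega)) (hout _ (by omega))
  linarith [triangular_sub_add_le m k]

lemma lap_pyramid_zero (m : ℕ) : lap (pyramid (d := d) m) 0 = -(2 * d * m) := by
  have h1 : ∀ i : Fin d, supNorm (Pi.single i 1 : Fin d → ℤ) = 1 := fun i => by
    refine le_antisymm (supNorm_le_iff.2 fun k => ?_) ?_
    · by_cases hk : k = i
      · subst hk; simp
      · simp [hk]
    · simpa using natAbs_le_supNorm (Pi.single i 1 : Fin d → ℤ) i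
  have h2 : ∀ i : Fin d, supNorm (-Pi.single i 1 : Fin d → ℤ) = 1 := fun i => by
    rw [← h1 i]
    simp [supNorm]
  have h0 : supNorm (0 : Fin d → ℤ) = 0 := by
    rw [← Nat.le_zero, supNorm_le_iff]; simp
  have h3 : triangular m - triangular (m - 1) = m := by
    cases m with
    | zero => simp
    | succ k => rw [triangular_succ]; simp
  simp only [lap, pyramid, zero_add, zero_sub, h1, h2, h0, Nat.sub_zero, Finset.sum_const,
    Finset.card_univ, Fintype.card_fin, nsmul_eq_mul]
  linear_combination (-2 * (d : ℤ)) * h3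

lemma isStabilizing_pyramid (hd : 1 ≤ d) (hh : h < 2 * (d : ℤ) - 1) :
    IsStabilizing d n h (pyramid n) where
  nonneg x := by
    rw [pyramid, ← triangular_zero]
    exact triangular_mono (Nat.zero_le _)
  height_le x := by
    by_cases hx : x = 0
    · subst hx
      rw [lap_pyramid_zero]
      have hd' : (1 : ℤ) ≤ d := by exact_mod_cast hd
      have hn : (0 : ℤ) ≤ n := Int.natCast_nonneg n
      simp only [initial, if_true]
      nlinarith
    · simp only [initial, if_neg hx]
      linarith [lap_pyramid_le_one n hx]

/-- If a stabilizing function vanishes off a finite set, then the total number of topplings left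
to `u` on that set decreases at every legal step, so toppling unstable sites must come to an
end. -/
lemma exists_isFinal_of_isStabilizing (hu : IsStabilizing d n h u) (B : Finset (Fin d → ℤ))
    (hB : ∀ x ∉ B, u x = 0) : ∃ η : Config d, IsFinal d n h η := by
  suffices key : ∀ (k : ℕ) (η : Config d), Reachable d n h η → ∑ x ∈ B, (u x - η.T x) ≤ k →
      ∃ η : Config d, IsFinal d n h η from
    key (∑ x ∈ B, (u x - (initial d n h).T x)).toNat (initial d n h)
      Relation.ReflTransGen.refl (Int.self_le_toNat _)
  intro k
  induction k with
  | zero =>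
    intro η hη hk
    refine ⟨η, hη, fun x => ?_⟩
    have hle := hη.le_of_isStabilizing hu
    have hnn : ∀ x ∈ B, 0 ≤ u x - η.T x := fun x _ => by linarith [hle x]
    have hzero := (Finset.sum_eq_zero_iff_of_nonneg hnn).1
      (le_antisymm (by simpa using hk) (Finset.sum_nonneg hnn))
    have heq : η.T = u := by
      ext x
      by_cases hx : x ∈ B
      · linarith [hzero x hx]
      · exact le_antisymm (hle x) (by rw [hB x hx]; exact hη.nonneg x)
    rw [hη.height_eq, heq]
    exact hu.height_le x
  | succ k ih =>
    intro η hη hk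
    by_cases hst : IsStable η
    · exact ⟨η, hη, hst⟩
    · simp only [IsStable, not_forall, not_le] at hst
      obtain ⟨x, hx⟩ := hst
      have hstep : Reachable d n h (topple η x) :=
        Relation.ReflTransGen.tail hη ⟨x, rfl, by rw [topple_H_self]; linarith⟩
      have hxB : x ∈ B := by
        by_contra hxB
        have h1 := hstep.le_of_isStabilizing hu x
        have h2 := hη.nonneg x
        rw [hB x hxB] at h1
        simp only [topple, if_true] at h1
        linarith
      refine ih _ hstep ?_
      have hsum : ∑ y ∈ B, (u y - (topple η x).T y) = ∑ y ∈ B, (u y - η.T y) - 1 := by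
        simp only [topple, ← sub_sub]
        rw [Finset.sum_sub_distrib]
        simp [hxB]
      rw [hsum]
      push_cast at hk
      linarith

lemma exists_isFinal (hd : 1 ≤ d) (hh : h < 2 * (d : ℤ) - 1) :
    ∃ η : Config d, IsFinal d n h η := by
  refine exists_isFinal_of_isStabilizing (isStabilizing_pyramid hd hh)
    (Finset.Icc (fun _ => -(n : ℤ)) fun _ => (n : ℤ)) fun x hx => ?_
  have hn : n ≤ supNorm x := by
    by_contra! hlt
    refine hx (Finset.mem_Icc.2 ⟨fun i => ?_, fun i => ?_⟩)
    all_goals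
      have := natAbs_le_supNorm x i
      simp only
      omega
  simp [pyramid, Nat.sub_eq_zero_of_le hn]

/-! ### Symmetry and monotonicity of the toppling function -/

lemma IsLeastStabilizing.comp_reflect_zero (hu : IsLeastStabilizing d n h u) (j : Fin d)
    (x : Fin d → ℤ) : u (reflect j 0 x) = u x := by
  have hst : IsStabilizing d n h fun y => u (reflect j 0 y) :=
    ⟨fun y => hu.nonneg _, fun y => by
      rw [lap_comp_reflect]
      refine le_trans (le_of_eq ?_) (hu.height_le (reflect j 0 y))
      simp only [initial, reflect_zero_eq_zero_iff]⟩
  refine le_antisymm ?_ (hu.le _ hst x)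
  simpa using hu.le _ hst (reflect j 0 x)

/-- The discrete moving plane argument. On the half space `x_j ≥ 1`, which does not contain the
origin, the least stabilizing function is at most its reflection in `x_j = 1 / 2`. -/
lemma IsLeastStabilizing.le_comp_reflect_one (hn : h < (n : ℤ)) (hu : IsLeastStabilizing d n h u)
    {j : Fin d} {x : Fin d → ℤ} (hx : 1 ≤ x j) : u x ≤ u (reflect j 1 x) := by
  set v : (Fin d → ℤ) → ℤ := fun y => if 1 ≤ y j then min (u y) (u (reflect j 1 y)) else u y
    with hv
  have hvu : ∀ y, v y ≤ u y := fun y => by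
    simp only [hv]; split_ifs
    · exact min_le_left _ _
    · exact le_rfl
  suffices hst : IsStabilizing d n h v by
    have := hu.le v hst x
    simp only [hv, if_pos hx] at this
    exact this.trans (min_le_right _ _)
  refine ⟨fun y => ?_, fun y => ?_⟩
  · simp only [hv]; split_ifs
    · exact le_min (hu.nonneg _) (hu.nonneg _)
    · exact hu.nonneg _
  by_cases hy : v y = u y
  · linarith [lap_le_lap hy (fun i => hvu _) fun i => hvu _, hu.height_le y]
  -- Otherwise `v` is the reflected function at `y`, and it lies below it at all neighbours of `y`.
  have hyj : 1 ≤ y j := by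
    by_contra hyj
    exact hy (by simp only [hv, if_neg hyj])
  have hvy : v y = u (reflect j 1 y) := by
    have : v y = min (u y) (u (reflect j 1 y)) := by simp only [hv, if_pos hyj]
    rcases min_choice (u y) (u (reflect j 1 y)) with h1 | h1
    · exact absurd (this.trans h1) hy
    · exact this.trans h1
  have hlt : u (reflect j 1 y) < u y := hvy ▸ (hvu y).lt_of_ne hy
  have hright : ∀ z : Fin d → ℤ, 1 ≤ z j → v z ≤ u (reflect j 1 z) := fun z hz => by
    simp only [hv, if_pos hz]
    exact min_le_right _ _
  have hlap : lap v y ≤ lap (fun z => u (reflect j 1 z)) y := by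
    refine lap_le_lap hvy (fun i => hright _ ?_) fun i => ?_
    · by_cases hij : j = i
      · subst hij; simp; omega
      · simpa [hij] using hyj
    · by_cases hz : 1 ≤ (y - Pi.single i 1 : Fin d → ℤ) j
      · exact hright _ hz
      -- The only neighbour in the other half space is the mirror image of `y`.
      · have hij : j = i := by
          by_contra hij
          exact hz (by simpa [hij] using hyj)
        subst hij
        have hmirror : y - Pi.single j 1 = reflect j 1 y := by
          simp at hz
          ext k
          by_cases hk : k = j
          · subst hk; simp [reflect]; omega
          · simp [reflect, hk]
        rw [hmirror, reflect_reflect]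
        exact (hvu _).trans hlt.le
  rw [lap_comp_reflect] at hlap
  have hinit : (initial d n h).H y ≤ (initial d n h).H (reflect j 1 y) := by
    have hy0 : y ≠ 0 := by rintro rfl; simp at hyj
    simp only [initial, if_neg hy0]
    split_ifs
    · exact hn.le
    · exact le_rfl
  linarith [hu.height_le (reflect j 1 y)]

lemma IsLeastStabilizing.update_natAbs (hu : IsLeastStabilizing d n h u) (x : Fin d → ℤ)
    (j : Fin d) (b : ℤ) : u (Function.update x j (b.natAbs : ℤ)) = u (Function.update x j b) := by
  rcases Int.natAbs_eq b with hb | hb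
  · rw [← hb]
  · have hr : Function.update x j (b.natAbs : ℤ) = reflect j 0 (Function.update x j b) := by
      simp only [reflect, Function.update_idem, Function.update_self]
      congr 1
      omega
    rw [hr, hu.comp_reflect_zero]

lemma IsLeastStabilizing.le_update (hn : h < (n : ℤ)) (hu : IsLeastStabilizing d n h u)
    {x : Fin d → ℤ} {j : Fin d} {b : ℤ} (hb : |b| ≤ |x j|) : u x ≤ u (Function.update x j b) := by
  have hanti : Antitone fun k : ℕ => u (Function.update x j (k : ℤ)) := by
    refine antitone_nat_of_succ_le fun k => ?_
    -- The reflection in `x_j = 1 / 2` sends `k + 1` to `-k`.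
    have h1 := hu.le_comp_reflect_one hn (j := j) (x := Function.update x j ((k + 1 : ℕ) : ℤ))
      (by simp)
    have h2 : reflect j 1 (Function.update x j ((k + 1 : ℕ) : ℤ)) =
        Function.update x j (-(k : ℤ)) := by
      simp [reflect]
    rwa [h2, ← hu.update_natAbs x j (-(k : ℤ)), Int.natAbs_neg, Int.natAbs_natCast] at h1
  have h1 := hanti (show b.natAbs ≤ (x j).natAbs by grind)
  simp only [hu.update_natAbs, Function.update_eq_self] at h1
  exact h1

/-- The least stabilizing function is nonincreasing in the absolute value of each coordinate. -/
lemma IsLeastStabilizing.le_of_abs_le (hn : h < (n : ℤ)) (hu : IsLeastStabilizing d n h u)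
    {x y : Fin d → ℤ} (hxy : ∀ i, |y i| ≤ |x i|) : u x ≤ u y := by
  suffices key : ∀ s : Finset (Fin d), u x ≤ u (s.piecewise y x) by
    simpa using key Finset.univ
  intro s
  induction s using Finset.induction_on with
  | empty => simp
  | insert j s hj ih =>
    rw [Finset.piecewise_insert]
    exact ih.trans (hu.le_update hn (by simpa [hj] using hxy j))

/-! ### The particle cluster -/

/-- Off the toppled sites and the origin, the height exceeds the background exactly at the
neighbours of toppled sites. -/
lemma Reachable.lt_height_iff (hη : Reachable d n h η) {x : Fin d → ℤ} (hx : x ≠ 0)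
    (hT : η.T x = 0) :
    h < η.H x ↔ ∃ i, 0 < η.T (x + Pi.single i 1) ∨ 0 < η.T (x - Pi.single i 1) := by
  rw [← lap_pos_iff hη.nonneg hT, hη.height_eq]
  simp [initial, hx]

/-- The origin lies in the particle cluster: if it does not topple, then no site does. -/
lemma IsFinal.zero_mem (hn : h < (n : ℤ)) (hη : IsFinal d n h η) :
    0 < η.T 0 ∨ h < η.H 0 := by
  have hr : Reachable d n h η := hη.1
  refine or_iff_not_imp_left.2 fun hT => ?_
  have hzero : η.T = fun _ => 0 := by
    ext z
    exact le_antisymm ((hη.isLeastStabilizing.le_of_abs_le hn fun i => by simp).trans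
      (not_lt.1 hT)) (hr.nonneg z)
  rw [hr.height_eq, hzero]
  simpa [initial, lap] using hn

/-- The sites of the particle cluster of a final configuration are closed under decreasing the
absolute values of the coordinates. -/
lemma IsFinal.mem_of_abs_le (hn : h < (n : ℤ)) (hη : IsFinal d n h η) {x y : Fin d → ℤ}
    (hxy : ∀ i, |y i| ≤ |x i|) (hx : 0 < η.T x ∨ h < η.H x) : 0 < η.T y ∨ h < η.H y := by
  have hr : Reachable d n h η := hη.1
  have hmono : ∀ {a b : Fin d → ℤ}, (∀ i, |b i| ≤ |a i|) → η.T a ≤ η.T b :=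
    hη.isLeastStabilizing.le_of_abs_le hn
  refine or_iff_not_imp_left.2 fun hTy => ?_
  replace hTy : η.T y = 0 := le_antisymm (not_lt.1 hTy) (hr.nonneg y)
  have hTx : η.T x = 0 := le_antisymm (hTy ▸ hmono hxy) (hr.nonneg x)
  replace hx : h < η.H x := hx.resolve_left (by omega)
  by_cases hy0 : y = 0
  · subst hy0
    exact (hη.zero_mem hn).resolve_left (by omega)
  have hx0 : x ≠ 0 := by
    rintro rfl
    exact hy0 (funext fun i => by simpa using hxy i)
  rw [hr.lt_height_iff hx0 hTx] at hx
  rw [hr.lt_height_iff hy0 hTy]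
  -- A toppled neighbour of the untoppled site `x` is closer to the hyperplane `x_i = 0`.
  obtain ⟨i, z, hz, hzi, hzk⟩ : ∃ i z, 0 < η.T z ∧ |z i| = |x i| - 1 ∧ ∀ k, k ≠ i → z k = x k := by
    have haux : ∀ (i : Fin d) (z : Fin d → ℤ), 0 < η.T z → (∀ k, k ≠ i → z k = x k) →
        |z i - x i| = 1 → |z i| = |x i| - 1 := fun i z hz hzk hd1 => by
      by_contra hne
      have : η.T z ≤ η.T x := hmono fun k => by
        by_cases hk : k = i
        · subst hk; grind
        · rw [hzk k hk]
      omega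
    obtain ⟨i, hi | hi⟩ := hx
    · have hk : ∀ k, k ≠ i → (x + Pi.single i 1 : Fin d → ℤ) k = x k := fun k hk => by simp [hk]
      exact ⟨i, _, hi, haux i _ hi hk (by simp), hk⟩
    · have hk : ∀ k, k ≠ i → (x - Pi.single i 1 : Fin d → ℤ) k = x k := fun k hk => by simp [hk]
      exact ⟨i, _, hi, haux i _ hi hk (by simp), hk⟩
  have hle : ∀ w : Fin d → ℤ, (∀ k, k ≠ i → w k = y k) → |w i| ≤ |x i| - 1 → 0 < η.T w :=
    fun w hwk hwi => hz.trans_le <| hmono fun k => by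
      by_cases hk : k = i
      · subst hk; omega
      · rw [hwk k hk, hzk k hk]; exact hxy k
  have hyi : |y i| = |x i| := by
    by_contra hne
    have := hxy i
    have := hle y (fun _ _ => rfl) (by omega)
    omega
  refine ⟨i, ?_⟩
  have h0 : 0 ≤ |z i| := abs_nonneg _
  obtain hs | hs := le_total 0 (y i)
  · exact Or.inr (hle _ (fun k hk => by simp [hk]) (by simp; grind))
  · exact Or.inl (hle _ (fun k hk => by simp [hk]) (by simp; grind))

/-- Scaling a point of the unit interval around the integer `a` by `t ∈ [0, 1]` gives a point of
the unit interval around an integer that is no larger in absolute value. -/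
lemma exists_int_abs_le_of_mul {a : ℤ} {p t : ℝ} (hp : |p - a| ≤ 1 / 2) (ht0 : 0 ≤ t)
    (ht1 : t ≤ 1) : ∃ b : ℤ, |b| ≤ |a| ∧ |t * p - b| ≤ 1 / 2 := by
  by_cases hta : |t * p - a| ≤ 1 / 2
  · exact ⟨a, le_rfl, hta⟩
  refine ⟨round (t * p), ?_, abs_sub_round _⟩
  -- `t p` lies between `0` and `p` but not in the interval around `a`, so an integer closest to it
  -- lies between `0` and `a`.
  have hr := abs_le.1 (abs_sub_round (t * p))
  rw [abs_le] at hp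
  rw [abs_le, not_and_or, not_le, not_le] at hta
  rcases hta with hta | hta
  · have hp0 : 0 ≤ p := by
      by_contra! hp0
      nlinarith
    have htp : 0 ≤ t * p := mul_nonneg ht0 hp0
    have h1 : (-1 : ℝ) < round (t * p) := by linarith
    have h2 : (round (t * p) : ℝ) < a := by linarith
    norm_cast at h1 h2
    grind
  · have hp0 : p ≤ 0 := by
      by_contra! hp0
      nlinarith
    have htp : t * p ≤ 0 := mul_nonpos_of_nonneg_of_nonpos ht0 hp0
    have h1 : (round (t * p) : ℝ) < 1 := by linarith
    have h2 : (a : ℝ) < round (t * p) := by linarith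
    norm_cast at h1 h2
    grind

lemma starConvex_iUnion_unitCube {S : Set (Fin d → ℤ)}
    (hS : ∀ x ∈ S, ∀ y : Fin d → ℤ, (∀ i, |y i| ≤ |x i|) → y ∈ S) :
    StarConvex ℝ 0 (⋃ x ∈ S, unitCube x) := by
  rw [starConvex_zero_iff]
  intro p hp t ht0 ht1
  simp only [Set.mem_iUnion, exists_prop] at hp ⊢
  obtain ⟨x, hx, hpx⟩ := hp
  choose y hy hty using fun i =>
    exists_int_abs_le_of_mul (abs_le.2 (hpx i)) ht0 ht1
  exact ⟨y, hS x hx y hy, fun i => abs_le.1 (hty i)⟩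

lemma IsFinal.isSimplyConnected_particleCluster (hn : h < (n : ℤ)) (hη : IsFinal d n h η) :
    IsSimplyConnected (particleCluster h η) := by
  have hS : particleCluster h η =
      ⋃ x ∈ {x : Fin d → ℤ | 0 < η.T x ∨ h < η.H x}, unitCube x := by
    rw [particleCluster, topplingCluster, ← Set.biUnion_union]
    rfl
  have hstar := starConvex_iUnion_unitCube
    (S := {x : Fin d → ℤ | 0 < η.T x ∨ h < η.H x}) fun x hx y hxy => hη.mem_of_abs_le hn hxy hx
  have hne : (⋃ x ∈ {x : Fin d → ℤ | 0 < η.T x ∨ h < η.H x}, unitCube x).Nonempty :=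
    ⟨0, Set.mem_biUnion (hη.zero_mem hn) fun i => by norm_num⟩
  have := hstar.contractibleSpace hne
  rw [hS, IsSimplyConnected]
  infer_instance

end Sandpile

theorem mainTheorem8 (d : ℕ) (hd : 1 ≤ d) (h : ℤ) (hh : h < 2 * (d : ℤ) - 1)
    (n : ℕ) (hn : h < (n : ℤ)) :
    (∃ η : Sandpile.Config d, Sandpile.IsFinal d n h η) ∧
      ∀ η : Sandpile.Config d, Sandpile.IsFinal d n h η →
        IsSimplyConnected (Sandpile.particleCluster h η) :=
  ⟨Sandpile.exists_isFinal hd hh, fun _ hη => hη.isSimplyConnected_particleCluster hn⟩
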